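/- Let $H$ be a complex Hilbert space and let $\mathcal M$ be a unital $O^*$-algebra on a dense subspace $\mathcal D\subseteq H$: an algebra of linear maps $\mathcal D\to\mathcal D$ that contains the identity and, with each $a$, the restriction to $\mathcal D$ of the adjoint $a^*$ (for instance $\mathcal M=dU(\mathcal E(\mathcal G))$ for a unitary representation $U$ of a Lie group $G$, with $\mathcal D$ the space of $C^\infty$-vectors). Let $X=\mathcal E_S(\mathcal M)$ be its state space: the positive trace class operators $\rho$ on $H$ with $\operatorname{Tr}\rho=1$, $\rho H\subseteq\mathcal D$ and $a\rho$ trace class for all $a\in\mathcal M$, with the coarsest topology for which all functions $\rho\mapsto\operatorname{Tr}(a\rho)$, $a\in\mathcal M$, are continuous. For essentially self-adjoint $a\in\mathcal M$ put $a_Q(\rho)=\operatorname{Tr}(a\rho)\in\mathbb R$. A real function on an open set $U\subseteq X$ is locally linear if every point of $U$ has an open neighbourhood in $U$ on which the function equals $a_Q$ for some essentially self-adjoint $a\in\mathcal M$. For a class $F$ of real functions on open subsets of $X$ and for $A\subseteq X$, let $F^0(A)$ be the prolongation by zero to $X$ of the sheaf of germs of $F$-functions restricted to $A$: a section over an open $U\subseteq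 X$ is a family $x=(x_\rho)_{\rho\in U}$ of germs of functions such that near each point of $U\cap A$ the germs $x_\sigma$, $\sigma\in A$, are those of one $F$-function, $x_\rho=0$ for $\rho\in U\setminus A$, and $\{\rho\in U: x_\rho\ne0\}$ is closed in $U$. Write $IQ^0_D(A)$ when $F$ consists of the locally linear functions, and $C^0(A)$ when $F$ consists of the continuous functions. The square $x^2$ of a section $x$ of $IQ^0_D(A)$, formed germ by germ, is a section of the sheaf of rings $C^0(A)$. The truth value of $x^2=0$ in the internal logic of the topos $\mathrm{Shv}(X)$ is the largest open subset of $U$ on which $x^2=0$; negation is the pseudo-complement of open sets; and a statement holds over $U$ if $U$ is contained in its truth value. 1. Let $A\subseteq X$ have empty interior. Then, for every open $U\subseteq X$, each section $x$ of $IQ^0_D(A)$ over $U$ (an infinitesimal locally linear qr-number) is an intuitionistic nilsquare infinitesimal: $\neg\neg(x^2=0)$ holds over $U$. 2. Let $A\subseteq X$ be locally closed with empty interior, let $U\subseteq X$ be open, and let $f:U\to\mathbb R$ be zero on $U\setminus A$ and such that each point of $U\cap A$ has an open neighbourhood $V$ with a locally linear function on $V$ that equals $f$ on $V\cap U\cap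 A$. Then $\neg\neg(f^2=0)$ holds over $U$, the truth value of $f^2=0$ being the largest open subset of $U$ on which $f^2=0$. 3. Suppose that $X$ has more than one point, and let $\rho_0\in X$. Then $\{\rho_0\}$ has empty interior. If moreover $\{\rho_0\}$ is closed in $X$, then for every open $U\subseteq X$ and every locally linear function $f$ on $U$ the family consisting of the germ of $f$ at $\rho_0$ (if $\rho_0\in U$) and of zero at all other points of $U$ is a section of $IQ^0_D(\{\rho_0\})$ over $U$, and it is an intuitionistic nilsquare infinitesimal. -/

import Mathlib

open CategoryTheory TopologicalSpace Opposite Filter Topology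
open scoped InnerProductSpace

universe u

namespace QRNumbers

/-! ### Operators on a dense domain, trace class operators, states -/

section States

variable {H : Type u} [NormedAddCommGroup H] [InnerProductSpace ℂ H]

/-- A (unital) O*-algebra on a dense linear subspace `D` of `H`: a subalgebra of the algebra of all
linear maps `D → D`, containing the identity, which with each `a` contains the restriction to `D`
of the Hilbert space adjoint of `a` (so that, in particular, the domain of that adjoint contains `D`
and the adjoint leaves `D` invariant). -/
structure OStarAlgebra (H : Type u) [NormedAddCommGroup H] [InnerProductSpace ℂ H] where
  /-- the common invariant domain -/
  D : Submodule ℂ H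
  dense : Dense (D : Set H)
  /-- the underlying algebra of operators -/
  ops : Subalgebra ℂ (Module.End ℂ D)
  exists_adjoint : ∀ a ∈ ops, ∃ b ∈ ops, ∀ φ ψ : D, ⟪(a φ : H), (ψ : H)⟫_ℂ = ⟪(φ : H), (b ψ : H)⟫_ℂ

/-- An everywhere defined linear operator `S` is of trace class if its trace norm is finite. The
trace norm `Tr |S|` is the supremum of `∑ |⟨f i, S (e i)⟩|` over all pairs of finite orthonormal
families (the case of one-element families says that `S` is bounded). -/
def IsTraceClass (S : H →ₗ[ℂ] H) : Prop :=
  ∃ C : ℝ, ∀ (n : ℕ) (e f : Fin n → H), Orthonormal ℂ e → Orthonormal ℂ f →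
    ∑ i, ‖⟪f i, S (e i)⟫_ℂ‖ ≤ C

/-- The trace, computed in an orthonormal basis; for trace class operators it does not depend on
the basis. -/
noncomputable def tr [CompleteSpace H] (S : H →ₗ[ℂ] H) : ℂ :=
  ∑' i : (exists_hilbertBasis ℂ H).choose, ⟪(i : H), S (i : H)⟫_ℂ

/-- The product `a T`, where `a : D → D` and where `T` maps `H` into `D`. -/
def opMul {D : Submodule ℂ H} (a : Module.End ℂ D) (T : H →L[ℂ] H) (hT : ∀ x, T x ∈ D) :
    H →ₗ[ℂ] H :=
  D.subtype ∘ₗ a ∘ₗ (T : H →ₗ[ℂ] H).codRestrict D hT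

variable [CompleteSpace H]

/-- The `*`-algebra `𝒯₁(M)`: trace class operators `T` with `T H ⊆ D`, `T* H ⊆ D` and with `a T`
and `a T*` of trace class for every `a` in `M`. -/
structure MemTraceIdeal (M : OStarAlgebra H) (T : H →L[ℂ] H) : Prop where
  traceClass : IsTraceClass (T : H →ₗ[ℂ] H)
  maps : ∀ x, T x ∈ M.D
  maps_adjoint : ∀ x, T.adjoint x ∈ M.D
  mul : ∀ a ∈ M.ops, IsTraceClass (opMul a T maps)
  mul_adjoint : ∀ a ∈ M.ops, IsTraceClass (opMul a T.adjoint maps_adjoint)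

/-- The state space of `M`: the positive (hence self-adjoint) operators of trace one in `𝒯₁(M)`. -/
structure State (M : OStarAlgebra H) where
  /-- the density operator -/
  op : H →L[ℂ] H
  mem : MemTraceIdeal M op
  pos : op.IsPositive
  trace_eq_one : tr (op : H →ₗ[ℂ] H) = 1

/-- `Tr (a ρ)` -/
noncomputable def expect {M : OStarAlgebra H} (a : M.ops) (ρ : State M) : ℂ :=
  tr (opMul (a : Module.End ℂ M.D) ρ.op ρ.mem.maps)

/-- The weak topology on the state space, the coarsest one for which `ρ ↦ Tr (a ρ)` is continuous
for each `a` in `M`. -/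
noncomputable instance (M : OStarAlgebra H) : TopologicalSpace (State M) :=
  TopologicalSpace.induced (fun ρ (a : M.ops) => expect a ρ) inferInstance

/-- The operator `a`, with domain `D`, is essentially self-adjoint: its closure is self-adjoint. -/
def IsESA {M : OStarAlgebra H} (a : M.ops) : Prop :=
  IsSelfAdjoint (LinearPMap.mk M.D (M.D.subtype ∘ₗ (a : Module.End ℂ M.D))).closure

/-- The function `a_Q (ρ) = Tr (a ρ)`, which is real for essentially self-adjoint `a`. -/
noncomputable def aQ {M : OStarAlgebra H} (a : M.ops) (ρ : State M) : ℝ := (expect a ρ).re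

/-- `f` is locally linear on the open set `U` (its values off `U` play no role): each point of `U`
has an open neighbourhood in `U` on which `f` is `a_Q` for an essentially self-adjoint `a` in `M`. -/
def LocallyLinear (M : OStarAlgebra H) (U : Opens (State M)) (f : State M → ℝ) : Prop :=
  ∀ ρ ∈ U, ∃ V : Opens (State M), ρ ∈ V ∧ V ≤ U ∧ ∃ a : M.ops, IsESA a ∧ ∀ σ ∈ V, f σ = aQ a σ

/-- Locally linear functions are continuous. -/
theorem LocallyLinear.continuousOn {M : OStarAlgebra H} (U : Opens (State M)) (f : State M → ℝ)
    (hf : LocallyLinear M U f) : ContinuousOn f U := by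
  intro ρ hρ
  obtain ⟨V, hρV, -, a, -, ha⟩ := hf ρ hρ
  have he : Continuous (fun (σ : State M) (b : M.ops) => expect b σ) := continuous_induced_dom
  have hc : Continuous (aQ a) := Complex.continuous_re.comp ((continuous_apply a).comp he)
  refine (hc.continuousAt.congr ?_).continuousWithinAt
  exact (V.isOpen.eventually_mem hρV).mono fun σ hσ => (ha σ hσ).symm

end States

/-! ### Prolongation by zero of sheaves of germs of functions -/

section Prolongation

variable {X : Type u} [TopologicalSpace X]

/-- Let `F` be a class of real functions on open subsets of `X`, and `A ⊆ X`. A section over `U` of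
the prolongation by zero to `X` of the sheaf of germs of `F`-functions, restricted to `A`, is a
family `s` of germs such that: over `U ∩ A` it is a continuous section of the restriction to `A` of
the sheaf of germs of `F`-functions; off `A` it is zero; its support is closed in `U` (that is, `s`
vanishes near each point of `U` at which it vanishes). -/
structure IsProlongedSection (F : Opens X → (X → ℝ) → Prop) (A : Set X) (U : Opens X)
    (s : ∀ x : U, (𝓝 (x : X)).Germ ℝ) : Prop where
  germs : ∀ x : U, (x : X) ∈ A → ∃ V : Opens X, (x : X) ∈ V ∧ ∃ f : X → ℝ, F V f ∧
    ∀ᶠ y : U in 𝓝 x, (y : X) ∈ A → s y = (f : (𝓝 (y : X)).Germ ℝ)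
  zero : ∀ x : U, (x : X) ∉ A → s x = 0
  closed_support : IsClosed {x : U | s x ≠ 0}

/-- Being a section of the prolongation by zero is a local property. -/
def prolongedLocal (F : Opens X → (X → ℝ) → Prop) (A : Set X) :
    TopCat.LocalPredicate (X := TopCat.of X) (fun x : X => (𝓝 x).Germ ℝ) where
  pred {U} s := IsProlongedSection F A U s
  res {U V} i s h :=
    have hc : Continuous (fun x : U => (⟨x, i.le x.2⟩ : V)) :=
      continuous_subtype_val.subtype_mk _
    { germs := fun x hx => by
        obtain ⟨W, hxW, f, hf, hs⟩ := h.germs ⟨x, i.le x.2⟩ hx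
        exact ⟨W, hxW, f, hf, (hc.tendsto x).eventually hs⟩
      zero := fun x hx => h.zero ⟨x, i.le x.2⟩ hx
      closed_support := h.closed_support.preimage hc }
  locality {U} s h :=
    { germs := fun x hx => by
        obtain ⟨V, hxV, i, hV⟩ := h x
        obtain ⟨W, hxW, f, hf, hs⟩ := hV.germs ⟨x, hxV⟩ hx
        refine ⟨W, hxW, f, hf, ?_⟩
        have ho : IsOpenEmbedding (fun y : V => (⟨y, i.le y.2⟩ : U)) :=
          Opens.isOpenEmbedding_of_le i.le
        have := ho.map_nhds_eq ⟨x, hxV⟩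
        rw [← this]
        exact hs
      zero := fun x hx => by
        obtain ⟨V, hxV, i, hV⟩ := h x
        exact hV.zero ⟨x, hxV⟩ hx
      closed_support := by
        rw [← isOpen_compl_iff, isOpen_iff_mem_nhds]
        intro x hx
        obtain ⟨V, hxV, i, hV⟩ := h x
        have ho : IsOpenEmbedding (fun y : V => (⟨y, i.le y.2⟩ : U)) :=
          Opens.isOpenEmbedding_of_le i.le
        have hm := ho.map_nhds_eq ⟨x, hxV⟩
        rw [← hm]
        exact hV.closed_support.isOpen_compl.mem_nhds (x := ⟨x, hxV⟩) hx }

/-- The prolongation by zero, as a sheaf of sets on `X`. -/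
def prolongation (F : Opens X → (X → ℝ) → Prop) (A : Set X) :
    TopCat.Sheaf (Type u) (TopCat.of X) :=
  TopCat.subsheafToTypes (prolongedLocal F A)

/-- The sections over `U` of the prolongation by zero. -/
abbrev Sections (F : Opens X → (X → ℝ) → Prop) (A : Set X) (U : Opens X) : Type u :=
  (prolongation F A).presheaf.obj (op U)

/-- The class of continuous functions: `C` in `C⁰(A)`. -/
def Cont (V : Opens X) (f : X → ℝ) : Prop := ContinuousOn f V

/-- Let `F` consist of continuous functions. The square of a section of `F⁰(A)`, formed with the
ring structure of the stalks, is a section of the sheaf of rings `C⁰(A)`, the prolongation by zero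
of the sheaf of germs of continuous functions. -/
def sq {F : Opens X → (X → ℝ) → Prop} {A : Set X} (hF : ∀ V f, F V f → Cont V f) {U : Opens X}
    (s : Sections F A U) : Sections (Cont (X := X)) A U :=
  ⟨fun x => s.1 x ^ 2,
    { germs := fun x hx => by
        obtain ⟨W, hxW, f, hf, hs⟩ := s.2.germs x hx
        exact ⟨W, hxW, f ^ 2, (hF W f hf).pow 2, hs.mono fun y hy hyA => by rw [hy hyA]; rfl⟩
      zero := fun x hx => by rw [s.2.zero x hx]; exact zero_pow two_ne_zero
      closed_support := by
        have key : ∀ (x : X) (g : (𝓝 x).Germ ℝ), g ^ 2 = 0 ↔ g = 0 := fun x g =>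
          Germ.inductionOn g fun f => by
            change ((f ^ 2 : X → ℝ) : (𝓝 x).Germ ℝ) = ((0 : X → ℝ) : (𝓝 x).Germ ℝ) ↔
              (f : (𝓝 x).Germ ℝ) = ((0 : X → ℝ) : (𝓝 x).Germ ℝ)
            rw [Germ.coe_eq, Germ.coe_eq]
            exact ⟨fun h => h.mono fun y hy => (pow_eq_zero_iff two_ne_zero).1 hy,
              fun h => h.mono fun y hy => (pow_eq_zero_iff two_ne_zero).2 hy⟩
        simpa only [ne_eq, key] using s.2.closed_support }⟩

/-- The zero section of `F⁰(A)`. -/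
def zeroSection (F : Opens X → (X → ℝ) → Prop) (A : Set X) (hF : ∀ V, F V 0) (U : Opens X) :
    Sections F A U :=
  ⟨fun _ => 0,
    { germs := fun x _ => ⟨U, x.2, 0, hF U, .of_forall fun _ _ => rfl⟩
      zero := fun _ _ => rfl
      closed_support := by simp }⟩

/-- The truth value of `s = t` in the internal logic of the topos of sheaves on `X`, for sections
`s`, `t` over `U`: the largest open subset of `U` on which `s` and `t` agree. Truth values are open
sets; negation is the complement in the Heyting algebra of open sets (the interior of the
set-theoretic complement); a truth value `p` holds over `U` if `U ≤ p`. -/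
def eqExtent (P : TopCat.Presheaf (Type u) (TopCat.of X)) {U : Opens X} (s t : P.obj (op U)) :
    Opens X :=
  sSup {V | ∃ h : V ≤ U, P.map (homOfLE h).op s = P.map (homOfLE h).op t}

/-- The section `x` of `F⁰(A)` over `U`, where `F` consists of continuous functions, is an
intuitionistic nilsquare infinitesimal: `¬¬ (x² = 0)` holds over `U`. -/
def IsIntuitionisticNilsquare {F : Opens X → (X → ℝ) → Prop} {A : Set X}
    (hF : ∀ V f, F V f → Cont V f) {U : Opens X} (x : Sections F A U) : Prop :=
  U ≤ (eqExtent (prolongation Cont A).presheaf (sq hF x)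
    (zeroSection Cont A (fun _ => continuousOn_const) U))ᶜᶜ

/-- The same for a real-valued function on `U`, regarded as a section of the sheaf of all
real-valued functions: `¬¬ (f² = 0)` holds over `U`. -/
def IsIntuitionisticNilsquareFun {U : Opens X} (f : U → ℝ) : Prop :=
  U ≤ (eqExtent (TopCat.presheafToType (TopCat.of X) ℝ) (U := U) (fun x => f x ^ 2)
    (fun _ => 0))ᶜᶜ

/-- The family of germs given by `f` at the points of `A` and by zero off `A`. -/
noncomputable def extendByZero (A : Set X) (f : X → ℝ) (U : Opens X) (x : U) :
    (𝓝 (x : X)).Germ ℝ :=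
  open Classical in if (x : X) ∈ A then (f : (𝓝 (x : X)).Germ ℝ) else 0

end Prolongation

end QRNumbers

open QRNumbers

namespace QRNumbers

/-! ### Linearity of the trace on trace class operators. -/

section TraceClass

variable {H : Type u} [NormedAddCommGroup H] [InnerProductSpace ℂ H]

/-! Double negation of an open set contains `U` as soon as the set is dense in `U`, so it suffices
that `x² = 0` on a dense open part of `U` (`le_compl_compl_of_subset_closure`). A section of a
prolongation by zero has closed support inside `A`; the complement of the support is open and
contains `U \ A`, which is dense in `U` when `A` has empty interior. A function has no closed
support to use, but a locally closed set with empty interior is nowhere dense, so `U` minus the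
closure of `A` serves instead.

For a single state, convexity gives the empty interior: the segment from one state to a different
one is a continuous path that leaves its starting point at once (`State.interior_singleton`). -/

theorem IsTraceClass.add {S T : H →ₗ[ℂ] H} (hS : IsTraceClass S) (hT : IsTraceClass T) :
    IsTraceClass (S + T) := by
  obtain ⟨C, hC⟩ := hS
  obtain ⟨C', hC'⟩ := hT
  refine ⟨C + C', fun n e f he hf => ?_⟩
  calc ∑ i, ‖⟪f i, (S + T) (e i)⟫_ℂ‖
      ≤ ∑ i, (‖⟪f i, S (e i)⟫_ℂ‖ + ‖⟪f i, T (e i)⟫_ℂ‖) :=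
        Finset.sum_le_sum fun i _ => by
          rw [LinearMap.add_apply, inner_add_right]
          exact norm_add_le _ _
    _ ≤ C + C' := by
        rw [Finset.sum_add_distrib]
        exact add_le_add (hC n e f he hf) (hC' n e f he hf)

theorem IsTraceClass.smul {S : H →ₗ[ℂ] H} (hS : IsTraceClass S) (c : ℂ) :
    IsTraceClass (c • S) := by
  obtain ⟨C, hC⟩ := hS
  refine ⟨‖c‖ * C, fun n e f he hf => ?_⟩
  simp only [LinearMap.smul_apply, inner_smul_right, norm_mul, ← Finset.mul_sum]
  exact mul_le_mul_of_nonneg_left (hC n e f he hf) (norm_nonneg c)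

/-- The diagonal matrix entries of a trace class operator are summable. -/
theorem IsTraceClass.summable_inner {S : H →ₗ[ℂ] H} (hS : IsTraceClass S) {ι : Type*} {b : ι → H}
    (hb : Orthonormal ℂ b) : Summable fun i => ⟪b i, S (b i)⟫_ℂ := by
  obtain ⟨C, hC⟩ := hS
  refine Summable.of_norm (summable_of_sum_le (c := C) (fun _ => norm_nonneg _) fun s => ?_)
  -- Enumerating a finite set of indices turns its partial sum into one bounded by `C`, with the
  -- same family in both slots.
  have he : Orthonormal ℂ fun i : Fin s.card => b (s.equivFin.symm i) :=
    hb.comp _ (Subtype.val_injective.comp s.equivFin.symm.injective)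
  refine le_trans (le_of_eq ?_) (hC s.card _ _ he he)
  rw [← Finset.sum_coe_sort]
  exact (Equiv.sum_comp s.equivFin.symm fun i : s => ‖⟪b i, S (b i)⟫_ℂ‖).symm

theorem opMul_add {D : Submodule ℂ H} (a : Module.End ℂ D) {S T : H →L[ℂ] H}
    (hS : ∀ x, S x ∈ D) (hT : ∀ x, T x ∈ D) (hST : ∀ x, (S + T) x ∈ D) :
    opMul a (S + T) hST = opMul a S hS + opMul a T hT := by
  ext x
  have : (⟨(S + T) x, hST x⟩ : D) = ⟨S x, hS x⟩ + ⟨T x, hT x⟩ := rfl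
  change ((a ⟨(S + T) x, hST x⟩ : D) : H) = a ⟨S x, hS x⟩ + a ⟨T x, hT x⟩
  rw [this, map_add]
  rfl

theorem opMul_smul {D : Submodule ℂ H} (a : Module.End ℂ D) (c : ℂ) {T : H →L[ℂ] H}
    (hT : ∀ x, T x ∈ D) (hcT : ∀ x, (c • T) x ∈ D) :
    opMul a (c • T) hcT = c • opMul a T hT := by
  ext x
  have : (⟨(c • T) x, hcT x⟩ : D) = c • ⟨T x, hT x⟩ := rfl
  change ((a ⟨(c • T) x, hcT x⟩ : D) : H) = c • (a ⟨T x, hT x⟩ : H)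
  rw [this, map_smul]
  rfl

variable [CompleteSpace H]

theorem tr_add {S T : H →ₗ[ℂ] H} (hS : IsTraceClass S) (hT : IsTraceClass T) :
    tr (S + T) = tr S + tr T := by
  obtain ⟨b, hb⟩ := (exists_hilbertBasis ℂ H).choose_spec
  have ho : Orthonormal ℂ ((↑) : (exists_hilbertBasis ℂ H).choose → H) := hb ▸ b.orthonormal
  simp only [tr, LinearMap.add_apply, inner_add_right]
  exact (hS.summable_inner ho).tsum_add (hT.summable_inner ho)

theorem tr_smul (c : ℂ) (S : H →ₗ[ℂ] H) : tr (c • S) = c * tr S := by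
  -- Summability is not needed: `tsum` is 0 on families that are not summable, and scaling respects
  -- this.
  simp only [tr, LinearMap.smul_apply, inner_smul_right, tsum_mul_left]

end TraceClass

/-! ### Convexity of the state space and absence of isolated points. -/

section Convexity

variable {H : Type u} [NormedAddCommGroup H] [InnerProductSpace ℂ H] [CompleteSpace H]
  {M : OStarAlgebra H}

/-- Membership in the trace ideal, for self-adjoint operators, only concerns the operator. -/
theorem MemTraceIdeal.of_isSelfAdjoint {T : H →L[ℂ] H} (hT : IsSelfAdjoint T)
    (tc : IsTraceClass (T : H →ₗ[ℂ] H)) (maps : ∀ x, T x ∈ M.D)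
    (mul : ∀ a ∈ M.ops, IsTraceClass (opMul a T maps)) : MemTraceIdeal M T := by
  have h : T.adjoint = T := hT
  refine ⟨tc, maps, h.symm ▸ maps, mul, fun a ha => ?_⟩
  simp only [h]
  exact mul a ha

/-- The convex combination `(1 - t) ρ + t σ` of two states. -/
noncomputable def State.mix (ρ σ : State M) (t : ℝ) (ht0 : 0 ≤ t) (ht1 : t ≤ 1) : State M :=
  have hp : (((1 - t : ℝ) : ℂ) • ρ.op + (t : ℂ) • σ.op).IsPositive :=
    (ρ.pos.smul_of_nonneg (by exact_mod_cast sub_nonneg.2 ht1)).add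
      (σ.pos.smul_of_nonneg (by exact_mod_cast ht0))
  have hρ : ∀ x, (((1 - t : ℝ) : ℂ) • ρ.op) x ∈ M.D := fun x => M.D.smul_mem _ (ρ.mem.maps x)
  have hσ : ∀ x, ((t : ℂ) • σ.op) x ∈ M.D := fun x => M.D.smul_mem _ (σ.mem.maps x)
  { op := ((1 - t : ℝ) : ℂ) • ρ.op + (t : ℂ) • σ.op
    pos := hp
    mem := .of_isSelfAdjoint hp.isSelfAdjoint
      ((ρ.mem.traceClass.smul _).add (σ.mem.traceClass.smul _))
      (fun x => M.D.add_mem (hρ x) (hσ x))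
      fun a ha => by
        rw [opMul_add a hρ hσ, opMul_smul a _ ρ.mem.maps, opMul_smul a _ σ.mem.maps]
        exact ((ρ.mem.mul a ha).smul _).add ((σ.mem.mul a ha).smul _)
    trace_eq_one := by
      change tr (((1 - t : ℝ) : ℂ) • (ρ.op : H →ₗ[ℂ] H) + (t : ℂ) • (σ.op : H →ₗ[ℂ] H)) = 1
      rw [tr_add (ρ.mem.traceClass.smul _) (σ.mem.traceClass.smul _), tr_smul, tr_smul,
        ρ.trace_eq_one, σ.trace_eq_one]
      push_cast
      ring }

/-- Since expectations induce the topology, this affine dependence on `t` makes segments continuous.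
-/
theorem State.expect_mix (ρ σ : State M) (t : ℝ) (ht0 : 0 ≤ t) (ht1 : t ≤ 1) (a : M.ops) :
    expect a (ρ.mix σ t ht0 ht1) = ((1 - t : ℝ) : ℂ) * expect a ρ + (t : ℂ) * expect a σ := by
  have hρ : ∀ x, (((1 - t : ℝ) : ℂ) • ρ.op) x ∈ M.D := fun x => M.D.smul_mem _ (ρ.mem.maps x)
  have hσ : ∀ x, ((t : ℂ) • σ.op) x ∈ M.D := fun x => M.D.smul_mem _ (σ.mem.maps x)
  change tr (opMul (a : Module.End ℂ M.D) (((1 - t : ℝ) : ℂ) • ρ.op + (t : ℂ) • σ.op)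
    (fun x => M.D.add_mem (hρ x) (hσ x))) = _
  rw [opMul_add _ hρ hσ, opMul_smul _ _ ρ.mem.maps, opMul_smul _ _ σ.mem.maps,
    tr_add ((ρ.mem.mul a a.2).smul _) ((σ.mem.mul a a.2).smul _), tr_smul, tr_smul]
  rfl

theorem State.op_injective : Function.Injective (State.op : State M → H →L[ℂ] H) := by
  rintro ⟨S, _, _, _⟩ ⟨T, _, _, _⟩ h
  cases h
  rfl

/-- The mixture differs from `ρ` by `t (σ - ρ)`, and `t` is invertible. -/
theorem State.mix_ne (ρ σ : State M) (h : σ ≠ ρ) (t : ℝ) (ht0 : 0 < t) (ht1 : t ≤ 1) :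
    ρ.mix σ t ht0.le ht1 ≠ ρ := by
  intro he
  apply h
  apply State.op_injective
  have h1 : ((1 - t : ℝ) : ℂ) • ρ.op + (t : ℂ) • σ.op = ρ.op := congrArg State.op he
  have h2 : (t : ℂ) • σ.op = (t : ℂ) • ρ.op := by
    rw [← sub_eq_zero]
    calc (t : ℂ) • σ.op - (t : ℂ) • ρ.op
        = (((1 - t : ℝ) : ℂ) • ρ.op + (t : ℂ) • σ.op) - ρ.op := by
          push_cast
          module
      _ = 0 := by rw [h1, sub_self]
  exact smul_right_injective _ (by exact_mod_cast ht0.ne' : (t : ℂ) ≠ 0) h2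

/-- The state space, if it has more than one point, has no isolated points. -/
theorem State.interior_singleton [Nontrivial (State M)] (ρ : State M) :
    interior {ρ} = (∅ : Set (State M)) := by
  obtain ⟨σ, hσ⟩ := exists_ne ρ
  by_contra hne
  have hn : {ρ} ∈ 𝓝 ρ := by
    obtain ⟨τ, hτ⟩ := Set.nonempty_iff_ne_empty.2 hne
    have he : τ = ρ := Set.mem_singleton_iff.1 (interior_subset hτ)
    exact mem_interior_iff_mem_nhds.1 (he ▸ hτ)
  let γ : Set.Icc (0 : ℝ) 1 → State M := fun t => ρ.mix σ t t.2.1 t.2.2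
  have hγ : Continuous γ := by
    refine continuous_induced_rng.2 (continuous_pi fun a => ?_)
    simp only [Function.comp_def, γ, State.expect_mix]
    fun_prop
  have h0 : γ 0 = ρ := State.op_injective <| by
    change ((1 - (0 : ℝ) : ℝ) : ℂ) • ρ.op + ((0 : ℝ) : ℂ) • σ.op = ρ.op
    simp
  have hev : ∀ᶠ t in 𝓝 (0 : Set.Icc (0 : ℝ) 1), γ t = ρ :=
    hγ.continuousAt.eventually (p := (· = ρ)) (by rw [h0]; exact hn)
  -- 0 is not isolated in `[0, 1]`, so some positive `t` still has `γ t = ρ`.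
  obtain ⟨t, ht, ht0⟩ := ((hev.filter_mono nhdsWithin_le_nhds).and
    (self_mem_nhdsWithin (a := (0 : Set.Icc (0 : ℝ) 1)) (s := {0}ᶜ))).exists
  have hpos : (0 : ℝ) < t := lt_of_le_of_ne t.2.1 fun h => ht0 (Subtype.ext h.symm)
  exact ρ.mix_ne σ hσ t hpos t.2.2 ht

end Convexity

/-! ### Dense truth values and sections supported on thin sets. -/

section Density

variable {X : Type u} [TopologicalSpace X]

/-- A point of `U` in the open set `Eᶜ` would, by density, force `Eᶜ` to meet `E`. -/
theorem le_compl_compl_of_subset_closure {U E : Opens X} (h : (U : Set X) ⊆ closure E) :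
    U ≤ Eᶜᶜ := by
  rw [le_compl_iff_disjoint_right, disjoint_iff_inf_le]
  rintro x ⟨hxU, hxE⟩
  obtain ⟨y, hyE, hy⟩ := mem_closure_iff.1 (h hxU) _ (Eᶜ).isOpen hxE
  have hbot : y ∈ (⊥ : Opens X) :=
    disjoint_iff_inf_le.1 (disjoint_compl_left (a := E)) ⟨hyE, hy⟩
  exact hbot.elim

theorem inter_compl_nonempty_of_interior_eq_empty {A O : Set X} (hA : interior A = ∅)
    (hO : IsOpen O) (hne : O.Nonempty) : (O ∩ Aᶜ).Nonempty :=
  (interior_eq_empty_iff_dense_compl.1 hA).inter_open_nonempty O hO hne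

/-- A locally closed set with empty interior is nowhere dense. -/
theorem isNowhereDense_of_isLocallyClosed {A : Set X} (hA : IsLocallyClosed A)
    (hi : interior A = ∅) : IsNowhereDense A := by
  obtain ⟨O, C, hO, hC, rfl⟩ := hA
  by_contra hne
  obtain ⟨x, hx⟩ := Set.nonempty_iff_ne_empty.2 hne
  obtain ⟨y, hyi, hy⟩ := mem_closure_iff.1 (interior_subset hx) _ isOpen_interior hx
  -- The closure of `O ∩ C` stays in `C`, so intersecting its interior with `O` gives an open subset
  -- of `O ∩ C`.
  have hsub : interior (closure (O ∩ C)) ∩ O ⊆ O ∩ C := fun z hz =>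
    ⟨hz.2, closure_minimal Set.inter_subset_right hC (interior_subset hz.1)⟩
  have : y ∈ interior (O ∩ C) :=
    interior_maximal hsub (isOpen_interior.inter hO) ⟨hyi, hy.1⟩
  rwa [hi] at this

/-- Sections of a prolongation by zero from a set with empty interior are infinitesimal. -/
theorem isIntuitionisticNilsquare_of_interior_eq_empty {F : Opens X → (X → ℝ) → Prop} {A : Set X}
    (hF : ∀ V f, F V f → Cont V f) (hA : interior A = ∅) {U : Opens X} (x : Sections F A U) :
    IsIntuitionisticNilsquare hF x := by
  refine le_compl_compl_of_subset_closure fun z hz => mem_closure_iff.2 fun O hO hzO => ?_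
  obtain ⟨y, ⟨hyO, hyU⟩, hyA⟩ :=
    inter_compl_nonempty_of_interior_eq_empty hA (hO.inter U.isOpen) ⟨z, hzO, hz⟩
  -- The complement of the support, viewed in `X`: open because the support is closed in `U`.
  let V : Opens X := ⟨Subtype.val '' {w : U | x.1 w ≠ 0}ᶜ,
    U.isOpen.isOpenMap_subtype_val _ x.2.closed_support.isOpen_compl⟩
  have hVU : V ≤ U := by
    rintro _ ⟨w, -, rfl⟩
    exact w.2
  refine ⟨y, hyO, ?_⟩
  refine Opens.mem_sSup.2 ⟨V, ⟨hVU, ?_⟩, ⟨y, hyU⟩, fun h => h (x.2.zero _ hyA), rfl⟩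
  refine Subtype.ext (funext fun w => ?_)
  obtain ⟨w, v, hv, rfl⟩ := w
  have hv0 : x.1 v = 0 := not_not.1 hv
  change x.1 v ^ 2 = 0
  rw [hv0]
  exact zero_pow two_ne_zero

theorem isIntuitionisticNilsquareFun_of_isNowhereDense {A : Set X} (hA : IsNowhereDense A)
    {U : Opens X} {f : U → ℝ} (hf : ∀ x : U, (x : X) ∉ A → f x = 0) :
    IsIntuitionisticNilsquareFun f := by
  refine le_compl_compl_of_subset_closure fun z hz => mem_closure_iff.2 fun O hO hzO => ?_
  obtain ⟨y, ⟨hyO, hyU⟩, hyA⟩ :=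
    inter_compl_nonempty_of_interior_eq_empty hA (hO.inter U.isOpen) ⟨z, hzO, hz⟩
  -- Removing the closure of `A`, not just `A`, keeps the set open.
  let V : Opens X := ⟨U ∩ (closure A)ᶜ, U.isOpen.inter isClosed_closure.isOpen_compl⟩
  refine ⟨y, hyO, Opens.mem_sSup.2 ⟨V, ⟨fun w hw => hw.1, funext fun w => ?_⟩, hyU, hyA⟩⟩
  have hw : f ⟨w, w.2.1⟩ = 0 := hf _ fun h => w.2.2 (subset_closure h)
  change f ⟨w, w.2.1⟩ ^ 2 = 0
  rw [hw]
  exact zero_pow two_ne_zero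

/-- The germ of an `F`-function at a closed point is a section of the prolongation by zero. -/
theorem isProlongedSection_extendByZero_singleton {F : Opens X → (X → ℝ) → Prop} {a : X}
    (ha : IsClosed {a}) {U : Opens X} {f : X → ℝ} (hf : F U f) :
    IsProlongedSection F {a} U (extendByZero {a} f U) where
  germs x _ := ⟨U, x.2, f, hf, .of_forall fun _ hy => if_pos hy⟩
  zero _ hx := if_neg hx
  closed_support := by
    have hsub : {x : U | extendByZero {a} f U x ≠ 0} ⊆ Subtype.val ⁻¹' {a} := fun x hx => by
      by_contra h
      exact hx (if_neg h)
    have hss : (Subtype.val ⁻¹' {a} : Set U).Subsingleton :=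
      Set.subsingleton_singleton.preimage Subtype.val_injective
    -- The support lies in a set with at most one point, so it is empty or all of that set; both are
    -- closed in `U`.
    rcases Set.eq_empty_or_nonempty {x : U | extendByZero {a} f U x ≠ 0} with h | ⟨x, hx⟩
    · rw [h]
      exact isClosed_empty
    · have : {x : U | extendByZero {a} f U x ≠ 0} = Subtype.val ⁻¹' {a} :=
        hsub.antisymm fun y hy => hss hy (hsub hx) ▸ hx
      rw [this]
      exact ha.preimage continuous_subtype_val

end Density

end QRNumbers

open QRNumbers

theorem theorem5 {H : Type u} [NormedAddCommGroup H] [InnerProductSpace ℂ H] [CompleteSpace H]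
    (M : OStarAlgebra H) :
    -- each section of the prolongation by zero of the germs of locally linear functions on `A`
    (∀ A : Set (State M), interior A = ∅ →
      ∀ (U : Opens (State M)) (x : Sections (LocallyLinear M) A U),
        IsIntuitionisticNilsquare LocallyLinear.continuousOn x) ∧
    -- the same for real-valued functions that are locally linear on `U ∩ A` and zero elsewhere
    (∀ A : Set (State M), IsLocallyClosed A → interior A = ∅ →
      ∀ (U : Opens (State M)) (f : U → ℝ),
        (∀ ρ : U, (ρ : State M) ∈ A → ∃ V : Opens (State M), (ρ : State M) ∈ V ∧
          ∃ g, LocallyLinear M V g ∧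
            ∀ σ : U, (σ : State M) ∈ V → (σ : State M) ∈ A → f σ = g σ) →
        (∀ ρ : U, (ρ : State M) ∉ A → f ρ = 0) →
        IsIntuitionisticNilsquareFun f) ∧
    -- the case of a single state
    (Nontrivial (State M) → ∀ ρ₀ : State M, interior {ρ₀} = ∅ ∧
      (IsClosed {ρ₀} → ∀ (U : Opens (State M)) (f : State M → ℝ), LocallyLinear M U f →
        ∃ x : Sections (LocallyLinear M) {ρ₀} U, x.1 = extendByZero {ρ₀} f U ∧
          IsIntuitionisticNilsquare LocallyLinear.continuousOn x)) := by
  refine ⟨fun A hA U x => isIntuitionisticNilsquare_of_interior_eq_empty _ hA x,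
    fun A hA hi U f _ hf =>
      isIntuitionisticNilsquareFun_of_isNowhereDense (isNowhereDense_of_isLocallyClosed hA hi) hf,
    fun _ ρ₀ => ⟨State.interior_singleton ρ₀, fun hc U f hf => ?_⟩⟩
  exact ⟨⟨extendByZero {ρ₀} f U, isProlongedSection_extendByZero_singleton hc hf⟩, rfl,
    isIntuitionisticNilsquare_of_interior_eq_empty _ (State.interior_singleton ρ₀) _⟩
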